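/- Let \(d\ge 2\), and let \(\mathcal{K}_d\) be the set of convex bodies in \(\mathbb{R}^d\), i.e. of convex, compact subsets of \(\mathbb{R}^d\) with non-empty interior, equipped with the Hausdorff distance. Let \(\mathcal{AT}_d\) be the group of invertible affine maps \(x\mapsto Lx+b\) of \(\mathbb{R}^d\), with \(L\in GL(d)\) and \(b\in\mathbb{R}^d\). An affine invariant point is a map \(p:\mathcal{K}_d\to\mathbb{R}^d\) which is continuous with respect to the Hausdorff distance and the Euclidean norm and satisfies \(p(T(C))=T(p(C))\) for all \(C\in\mathcal{K}_d\) and \(T\in\mathcal{AT}_d\). For \(C\in\mathcal{K}_d\) put \[ \mathfrak{F}_d(C)=\{x\in\mathbb{R}^d:\ T(x)=x\text{ for every }T\in\mathcal{AT}_d\text{ with }T(C)=C\}. \] Let \(K_1,\dots,K_m\in\mathcal{K}_d\) be pairwise not affinely equivalent, i.e. for \(i\neq j\) there is no \(T\in\mathcal{AT}_d\) with \(T(K_i)=K_j\), and let \(x_i\in\mathfrak{F}_d(K_i)\) for \(1\le i\le m\). Then there is an affine invariant point \(p\) such that \(p(K_i)=x_i\) for all \(1\le i\le m\). -/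

import Mathlib

/-- `𝒦_d`: convex, compact subsets of Euclidean space `ℝᵈ` with non-empty interior. It carries the
Hausdorff distance, inherited from Mathlib's metric on `ConvexBody`. -/
abbrev FullConvexBody (d : ℕ) : Type :=
  {K : ConvexBody (EuclideanSpace ℝ (Fin d)) //
    (interior (K : Set (EuclideanSpace ℝ (Fin d)))).Nonempty}

/-- The group of invertible affine transformations `x ↦ L x + b` of `ℝᵈ`. -/
abbrev AffTransf (d : ℕ) : Type :=
  EuclideanSpace ℝ (Fin d) ≃ᵃ[ℝ] EuclideanSpace ℝ (Fin d)

namespace FullConvexBody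

/-- The image `T(C)` of a convex body `C` under an invertible affine map `T`. -/
def map {d : ℕ} (T : AffTransf d) (C : FullConvexBody d) : FullConvexBody d :=
  ⟨{ carrier := T '' (C.1 : Set (EuclideanSpace ℝ (Fin d)))
     convex' := C.1.convex.affine_image T.toAffineMap
     isCompact' := C.1.isCompact.image T.toAffineMap.continuous_of_finiteDimensional
     nonempty' := C.1.nonempty.image T }, by
    have h := ((AffineEquiv.toContinuousAffineEquiv T).toHomeomorph.image_interior
      (C.1 : Set (EuclideanSpace ℝ (Fin d))))
    exact (C.2.image T).mono h.subset⟩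

theorem coe_map {d : ℕ} (T : AffTransf d) (C : FullConvexBody d) :
    ((map T C).1 : Set (EuclideanSpace ℝ (Fin d))) = T '' (C.1 : Set _) :=
  rfl

/-- `C₁` and `C₂` are affinely equivalent if `T(C₁) = C₂` for some invertible affine `T`. -/
def AffinelyEquivalent {d : ℕ} (C₁ C₂ : FullConvexBody d) : Prop :=
  ∃ T : AffTransf d, map T C₁ = C₂

/-- `𝔉_d(C)`: the points fixed by every invertible affine `T` with `T(C) = C`. -/
def fixedPoints {d : ℕ} (C : FullConvexBody d) : Set (EuclideanSpace ℝ (Fin d)) :=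
  {x | ∀ T : AffTransf d, map T C = C → T x = x}

end FullConvexBody

/-- Affine invariant points: maps `p : 𝒦_d → ℝᵈ`, continuous for the Hausdorff distance and the
Euclidean norm, with `p(T(C)) = T(p(C))` for all `C` and all invertible affine `T`. -/
structure IsAffineInvariantPoint {d : ℕ}
    (p : FullConvexBody d → EuclideanSpace ℝ (Fin d)) : Prop where
  continuous : Continuous p
  map_eq : ∀ (T : AffTransf d) (C : FullConvexBody d), p (FullConvexBody.map T C) = T (p C)

open MeasureTheory Filter Topology

/-! The affine group acts properly on full-dimensional bodies: if `T n` moves `C` to a convergent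
sequence of bodies with full-dimensional limit, a subsequence of `T n` converges to an invertible
map (`exists_subseq_tendsto_ofAff`). Hence orbits are closed, and `T(K i) ↦ T (x i)` is well defined
(`x i` is fixed by the stabilizer, the orbits are disjoint) and continuous on the finite union of
the orbits. Tietze extends it to a continuous `y`, in general not equivariant
(`exists_continuous_map_eq`).

Equivariance is restored by averaging over the group: `p(C) = ∫ w(T⁻¹C) T(y(T⁻¹C)) dT / ∫ w(T⁻¹C)
dT`. The weight `w` is a cutoff for which only a bounded set of `T` contributes at each `C`, locally
uniformly in `C` (`norm_ofAff_le_of_frameWeight_ne_zero`). Here `dT` is Lebesgue measure on pairs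
`(L, b)`; left multiplication only rescales it, and the factor cancels in the quotient. Where `y` is
already equivariant, `T(y(T⁻¹C)) = y(C)`, so the average changes nothing and `p(K i) = x i`. -/

/-- Pairs `(L, b)`, encoding the affine self-maps `x ↦ L x + b` of `ℝᵈ`. -/
abbrev AffCode (d : ℕ) : Type :=
  (EuclideanSpace ℝ (Fin d) →L[ℝ] EuclideanSpace ℝ (Fin d)) × EuclideanSpace ℝ (Fin d)

/-! ### Affine maps as an open subset of a normed space. -/

namespace AffCode

variable {d : ℕ}

/-- The affine map encoded by a pair `(L, b)`. -/
def eval (v : AffCode d) (z : EuclideanSpace ℝ (Fin d)) : EuclideanSpace ℝ (Fin d) := v.1 z + v.2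

/-- The pair encoding an invertible affine map. -/
noncomputable def ofAff (T : AffTransf d) : AffCode d :=
  (LinearMap.toContinuousLinearMap (T.linear : EuclideanSpace ℝ (Fin d) →ₗ[ℝ] _), T 0)

theorem ofAff_fst_apply (T : AffTransf d) (z : EuclideanSpace ℝ (Fin d)) :
    (ofAff T).1 z = T.linear z := rfl

theorem eval_ofAff (T : AffTransf d) (z : EuclideanSpace ℝ (Fin d)) : (ofAff T).eval z = T z := by
  have h := T.map_vadd 0 z
  simp only [vadd_eq_add, add_zero] at h
  rw [eval, ofAff_fst_apply, h]
  rfl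

theorem ofAff_injective : Function.Injective (ofAff (d := d)) := fun S T h => by
  ext1 z
  rw [← eval_ofAff, ← eval_ofAff, h]

theorem exists_ofAff_eq {v : AffCode d} (hv : Function.Surjective v.1) :
    ∃ T : AffTransf d, ofAff T = v := by
  have hb : Function.Bijective v.1 := ⟨(LinearMap.injective_iff_surjective
    (f := (v.1 : EuclideanSpace ℝ (Fin d) →ₗ[ℝ] _))).2 hv, hv⟩
  refine ⟨(LinearEquiv.ofBijective (v.1 : EuclideanSpace ℝ (Fin d) →ₗ[ℝ] _) hb).toAffineEquiv.trans
    (AffineEquiv.constVAdd ℝ _ v.2), ?_⟩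
  refine Prod.ext ?_ ?_
  · ext1 z
    rfl
  · simp [ofAff]

theorem range_ofAff : Set.range (ofAff (d := d)) = {v | IsUnit v.1} := by
  ext v
  constructor
  · rintro ⟨T, rfl⟩
    refine ⟨⟨(ofAff T).1, (ofAff T.symm).1, ?_, ?_⟩, rfl⟩
    · ext1 z
      exact T.linear.apply_symm_apply z
    · ext1 z
      exact T.linear.symm_apply_apply z
  · rintro ⟨u, hu⟩
    refine exists_ofAff_eq fun z => ⟨(↑u⁻¹ : EuclideanSpace ℝ (Fin d) →L[ℝ] _) z, ?_⟩
    rw [← hu]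
    exact DFunLike.congr_fun u.mul_inv z

theorem isOpen_range_ofAff : IsOpen (Set.range (ofAff (d := d))) := by
  rw [range_ofAff]
  exact Units.isOpen.preimage continuous_fst

theorem ofAff_symm (T : AffTransf d) :
    ofAff T.symm = (Ring.inverse (ofAff T).1, -(Ring.inverse (ofAff T).1 (T 0))) := by
  have h : Ring.inverse (ofAff T).1 = (ofAff T.symm).1 := by
    have hu : (ofAff T).1 * (ofAff T.symm).1 = 1 := by
      ext1 z
      exact T.linear.apply_symm_apply z
    have hu' : (ofAff T.symm).1 * (ofAff T).1 = 1 := by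
      ext1 z
      exact T.linear.symm_apply_apply z
    exact Ring.inverse_unit ⟨_, _, hu, hu'⟩
  rw [h]
  refine Prod.ext rfl ?_
  have := eval_ofAff T.symm (T 0)
  rw [eval, T.symm_apply_apply] at this
  exact (eq_neg_of_add_eq_zero_right this)

/-- The invertible affine map encoded by a pair. -/
noncomputable def toAff (v : AffCode d) : AffTransf d := Function.invFun ofAff v

theorem toAff_ofAff (T : AffTransf d) : toAff (ofAff T) = T :=
  Function.leftInverse_invFun ofAff_injective T

theorem ofAff_toAff {v : AffCode d} (hv : v ∈ Set.range (ofAff (d := d))) : ofAff (toAff v) = v :=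
  Function.invFun_eq hv

/-- Inversion in a complete normed ring is continuous at units. Off the range `toAff` takes junk
values, so continuity is only claimed on the range. -/
theorem continuousOn_ofAff_toAff_symm :
    ContinuousOn (fun v : AffCode d => ofAff (toAff v).symm) (Set.range ofAff) := by
  have h : ContinuousOn (fun v : AffCode d => Ring.inverse v.1) (Set.range ofAff) := by
    intro v hv
    rw [range_ofAff] at hv
    obtain ⟨u, hu⟩ := hv
    have := NormedRing.inverse_continuousAt u
    rw [hu] at this
    exact (ContinuousAt.comp (f := Prod.fst) this continuous_fst.continuousAt).continuousWithinAt
  have h2 : ContinuousOn (fun v : AffCode d => (Ring.inverse v.1, -(Ring.inverse v.1 v.2)))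
      (Set.range ofAff) := h.prodMk (h.clm_apply continuousOn_snd).neg
  refine h2.congr fun v hv => ?_
  obtain ⟨T, rfl⟩ := hv
  simp only [toAff_ofAff, ofAff_symm]
  rfl

/-- The image of a convex body under the affine map encoded by a pair. -/
def image (v : AffCode d) (C : ConvexBody (EuclideanSpace ℝ (Fin d))) :
    ConvexBody (EuclideanSpace ℝ (Fin d)) where
  carrier := v.eval '' C
  convex' := C.convex.affine_image (v.1.toLinearMap.toAffineMap + AffineMap.const ℝ _ v.2)
  isCompact' := C.isCompact.image (v.1.continuous.add continuous_const)
  nonempty' := C.nonempty.image _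

theorem coe_image (v : AffCode d) (C : ConvexBody (EuclideanSpace ℝ (Fin d))) :
    (v.image C : Set (EuclideanSpace ℝ (Fin d))) = v.eval '' C := rfl

theorem image_ofAff (T : AffTransf d) (C : FullConvexBody d) :
    (ofAff T).image C.1 = (FullConvexBody.map T C).1 := by
  apply ConvexBody.ext
  rw [coe_image, FullConvexBody.coe_map, funext (eval_ofAff T)]

theorem dist_image_left_le (v w : AffCode d) (C : ConvexBody (EuclideanSpace ℝ (Fin d))) {R : ℝ}
    (hR : ∀ z ∈ C, ‖z‖ ≤ R) :
    dist (v.image C) (w.image C) ≤ ‖v.1 - w.1‖ * R + ‖v.2 - w.2‖ := by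
  have hR0 : 0 ≤ R := by
    obtain ⟨z, hz⟩ := C.nonempty
    exact (norm_nonneg z).trans (hR z hz)
  have key : ∀ z ∈ C, dist (v.eval z) (w.eval z) ≤ ‖v.1 - w.1‖ * R + ‖v.2 - w.2‖ := by
    intro z hz
    rw [dist_eq_norm, eval, eval, add_sub_add_comm, ← sub_apply]
    refine (norm_add_le _ _).trans ?_
    gcongr
    exact ((v.1 - w.1).le_opNorm z).trans (by gcongr; exact hR z hz)
  refine Metric.hausdorffDist_le_of_mem_dist (by positivity) ?_ ?_
  · rintro _ ⟨z, hz, rfl⟩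
    exact ⟨_, ⟨z, hz, rfl⟩, key z hz⟩
  · rintro _ ⟨z, hz, rfl⟩
    exact ⟨_, ⟨z, hz, rfl⟩, (dist_comm _ _).trans_le (key z hz)⟩

theorem _root_.ConvexBody.exists_dist_le {C C' : ConvexBody (EuclideanSpace ℝ (Fin d))}
    {z : EuclideanSpace ℝ (Fin d)} (hz : z ∈ C) : ∃ z' ∈ C', dist z z' ≤ dist C C' := by
  obtain ⟨z', hz', h⟩ := C'.isCompact.exists_infDist_eq_dist C'.nonempty z
  exact ⟨z', hz', h ▸ Metric.infDist_le_hausdorffDist_of_mem hz ConvexBody.hausdorffEDist_ne_top⟩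

theorem dist_image_right_le (v : AffCode d) (C C' : ConvexBody (EuclideanSpace ℝ (Fin d))) :
    dist (v.image C) (v.image C') ≤ ‖v.1‖ * dist C C' := by
  have key : ∀ z z', dist z z' ≤ dist C C' → dist (v.eval z) (v.eval z') ≤ ‖v.1‖ * dist C C' := by
    intro z z' h
    rw [eval, eval, dist_add_right, dist_eq_norm, ← map_sub]
    refine (v.1.le_opNorm _).trans ?_
    gcongr
    rwa [← dist_eq_norm]
  refine Metric.hausdorffDist_le_of_mem_dist (by positivity) ?_ ?_
  · rintro _ ⟨z, hz, rfl⟩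
    obtain ⟨z', hz', h⟩ := ConvexBody.exists_dist_le (C' := C') hz
    exact ⟨_, ⟨z', hz', rfl⟩, key _ _ h⟩
  · rintro _ ⟨z, hz, rfl⟩
    obtain ⟨z', hz', h⟩ := ConvexBody.exists_dist_le (C' := C) hz
    exact ⟨_, ⟨z', hz', rfl⟩, key _ _ (h.trans_eq (dist_comm _ _))⟩

theorem continuous_image_left (C : ConvexBody (EuclideanSpace ℝ (Fin d))) :
    Continuous fun v : AffCode d => v.image C := by
  obtain ⟨R, hR⟩ := C.isBounded.exists_norm_le
  refine continuous_iff_continuousAt.2 fun w => ?_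
  rw [ContinuousAt, tendsto_iff_dist_tendsto_zero]
  have h : Continuous fun v : AffCode d => ‖v.1 - w.1‖ * R + ‖v.2 - w.2‖ := by fun_prop
  have h0 := h.tendsto w
  simp only [sub_self, norm_zero, zero_mul, add_zero] at h0
  exact squeeze_zero (fun _ => dist_nonneg) (fun v => dist_image_left_le v w C hR) h0

theorem continuous_image_right (v : AffCode d) : Continuous v.image := by
  refine (LipschitzWith.of_dist_le_mul (K := ‖v.1‖₊) fun C C' => ?_).continuous
  exact dist_image_right_le v C C'

end AffCode

/-! ### Properness of the affine action and closed orbits. -/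

namespace FullConvexBody

variable {d : ℕ}

theorem map_map (S T : AffTransf d) (C : FullConvexBody d) : map S (map T C) = map (S * T) C := by
  apply Subtype.ext
  apply ConvexBody.ext
  rw [coe_map, coe_map, coe_map, Set.image_image]
  rfl

theorem map_one (C : FullConvexBody d) : map 1 C = C := by
  apply Subtype.ext
  apply ConvexBody.ext
  rw [coe_map]
  exact Set.image_id _

theorem map_inv_map (T : AffTransf d) (C : FullConvexBody d) : map T⁻¹ (map T C) = C := by
  rw [map_map, inv_mul_cancel, map_one]

theorem continuous_map (T : AffTransf d) : Continuous (map T) := by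
  refine Continuous.subtype_mk ?_ _
  have h := (AffCode.continuous_image_right (AffCode.ofAff T)).comp
    (continuous_subtype_val (p := fun C : ConvexBody (EuclideanSpace ℝ (Fin d)) =>
      (interior (C : Set (EuclideanSpace ℝ (Fin d)))).Nonempty))
  exact h.congr fun C => AffCode.image_ofAff T C

theorem continuousOn_map_toAff_inv (C : FullConvexBody d) :
    ContinuousOn (fun v : AffCode d => map (AffCode.toAff v)⁻¹ C) (Set.range AffCode.ofAff) := by
  refine Topology.IsInducing.subtypeVal.continuousOn_iff.2 ?_
  exact ((AffCode.continuous_image_left C.1).comp_continuousOn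
    AffCode.continuousOn_ofAff_toAff_symm).congr fun v _ => (AffCode.image_ofAff _ C).symm

/-- A set of affine maps moving a fixed full-dimensional body inside a fixed ball is bounded. -/
theorem exists_norm_ofAff_le (C : FullConvexBody d) (R : ℝ) : ∃ M, ∀ T : AffTransf d,
    (∀ z ∈ (map T C).1, ‖z‖ ≤ R) → ‖AffCode.ofAff T‖ ≤ M := by
  obtain ⟨c, hc⟩ := C.2
  obtain ⟨ρ, hρ, hball⟩ := Metric.isOpen_iff.1 isOpen_interior c hc
  have hsub : Metric.ball c ρ ⊆ (C.1 : Set (EuclideanSpace ℝ (Fin d))) :=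
    hball.trans interior_subset
  refine ⟨max (2 * R / (ρ / 2)) (R + 2 * R / (ρ / 2) * ‖c‖), fun T hT => ?_⟩
  have hTz : ∀ z ∈ Metric.ball c ρ, ‖T z‖ ≤ R := fun z hz => hT _ ⟨z, hsub hz, rfl⟩
  have hTc := hTz c (Metric.mem_ball_self hρ)
  have hR : 0 ≤ R := (norm_nonneg _).trans hTc
  have hlin : ∀ u : EuclideanSpace ℝ (Fin d), T (u + c) = T.linear u + T c := fun u => T.map_vadd c u
  have hL : ‖(AffCode.ofAff T).1‖ ≤ 2 * R / (ρ / 2) := by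
    -- On the shell `ρ / 2 ≤ ‖u‖ < ρ`, the vector `T.linear u` is a difference of two points of the
    -- ball of radius `R`.
    refine ContinuousLinearMap.opNorm_le_of_shell (ε := ρ) (c := (2 : ℝ)) hρ (by positivity)
      (by norm_num) fun u hu1 hu2 => ?_
    have h1 : T.linear u = T (u + c) - T c := by rw [hlin]; abel
    rw [AffCode.ofAff_fst_apply, h1]
    have h3 : ‖T (u + c)‖ ≤ R := hTz _ (by simpa using hu2)
    have h4 : ρ / 2 ≤ ‖u‖ := by simpa using hu1
    calc ‖T (u + c) - T c‖ ≤ 2 * R := (norm_sub_le _ _).trans (by linarith)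
      _ = 2 * R / (ρ / 2) * (ρ / 2) := by field_simp
      _ ≤ 2 * R / (ρ / 2) * ‖u‖ := by gcongr
  refine max_le_max hL ?_
  have h0 : T 0 = T c - (AffCode.ofAff T).1 c := by
    have := AffCode.eval_ofAff T c
    rw [← this, AffCode.eval]
    simp [AffCode.ofAff]
  change ‖T 0‖ ≤ _
  rw [h0]
  refine (norm_sub_le _ _).trans (add_le_add hTc (((AffCode.ofAff T).1.le_opNorm c).trans ?_))
  gcongr

theorem norm_le_of_dist_le {C C' : FullConvexBody d} {R r : ℝ} (hR : ∀ z ∈ C.1, ‖z‖ ≤ R)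
    (h : dist C' C ≤ r) : ∀ z ∈ C'.1, ‖z‖ ≤ R + r := by
  intro z hz
  obtain ⟨z', hz', hd⟩ := ConvexBody.exists_dist_le (C' := C.1) hz
  have h1 : ‖z - z'‖ ≤ r := by
    rw [← dist_eq_norm]
    exact hd.trans h
  have := norm_le_norm_add_norm_sub z' z
  linarith [hR z' hz', norm_sub_rev z z']

/-- The action of the affine group on full-dimensional bodies is proper. -/
theorem exists_subseq_tendsto_ofAff (C C' : FullConvexBody d) (T : ℕ → AffTransf d)
    (h : Tendsto (fun n => map (T n) C) atTop (𝓝 C')) :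
    ∃ S : AffTransf d, map S C = C' ∧ ∃ φ : ℕ → ℕ, StrictMono φ ∧
      Tendsto (fun n => AffCode.ofAff (T (φ n))) atTop (𝓝 (AffCode.ofAff S)) := by
  obtain ⟨R, hR⟩ := C'.1.isBounded.exists_norm_le
  obtain ⟨M, hM⟩ := exists_norm_ofAff_le C (R + 1)
  have hev : ∀ᶠ n in atTop, AffCode.ofAff (T n) ∈ Metric.closedBall (0 : AffCode d) M := by
    filter_upwards [h (Metric.closedBall_mem_nhds C' one_pos)] with n hn
    rw [mem_closedBall_zero_iff]
    exact hM _ (norm_le_of_dist_le hR hn)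
  obtain ⟨v, -, φ, hφ, hv⟩ :=
    (isCompact_closedBall (0 : AffCode d) M).tendsto_subseq' hev.frequently
  have h1 : v.image C.1 = C'.1 := by
    refine tendsto_nhds_unique (((AffCode.continuous_image_left C.1).tendsto v).comp hv) ?_
    have h2 := ((continuous_subtype_val.tendsto C').comp h).comp hφ.tendsto_atTop
    exact h2.congr fun n => (AffCode.image_ofAff _ _).symm
  -- The limit map cannot degenerate: its image of `C` is `C'`, which has interior points.
  have hsurj : Function.Surjective v.1 := by
    obtain ⟨c, hc⟩ := C'.2
    have hrange : LinearMap.range v.1.toLinearMap = ⊤ := by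
      obtain ⟨c', -, hc'⟩ : c ∈ v.eval '' C.1 := by
        rw [← AffCode.coe_image, h1]
        exact interior_subset hc
      refine Submodule.eq_top_of_nonempty_interior' _ ⟨c - v.2, ?_⟩
      rw [mem_interior_iff_mem_nhds] at hc ⊢
      have ht : Tendsto (fun z => z + v.2) (𝓝 (c - v.2)) (𝓝 c) := by
        have : Continuous fun z : EuclideanSpace ℝ (Fin d) => z + v.2 := by fun_prop
        simpa using this.tendsto (c - v.2)
      filter_upwards [ht hc] with z hz
      rw [Set.mem_preimage, ← h1] at hz
      obtain ⟨u, -, hu⟩ := hz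
      exact ⟨u, add_right_cancel hu⟩
    exact LinearMap.range_eq_top.1 hrange
  obtain ⟨S, rfl⟩ := AffCode.exists_ofAff_eq hsurj
  exact ⟨S, Subtype.ext ((AffCode.image_ofAff S C).symm.trans h1), φ, hφ, hv⟩

theorem isClosed_orbit (C : FullConvexBody d) : IsClosed (Set.range fun T => map T C) := by
  refine IsSeqClosed.isClosed fun u C' hu hlim => ?_
  choose T hT using hu
  obtain ⟨S, hS, -⟩ := exists_subseq_tendsto_ofAff C C' T (by simpa only [hT] using hlim)
  exact ⟨S, hS⟩

/-- An equivariant map is continuous on each orbit. -/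
theorem continuousOn_orbit {C : FullConvexBody d} {x : EuclideanSpace ℝ (Fin d)}
    {y : FullConvexBody d → EuclideanSpace ℝ (Fin d)} (hy : ∀ T, y (map T C) = T x) :
    ContinuousOn y (Set.range fun T => map T C) := by
  rw [continuousOn_iff_continuous_domRestrict]
  refine continuous_iff_seqContinuous.2 fun u C' hu => tendsto_of_subseq_tendsto fun ns hns => ?_
  -- Along a subsequence the maps `T n` converge to some `S`, so `T n x` converges to `S x`.
  choose T hT using fun n => (u (ns n)).2
  have hlim := (continuous_subtype_val.tendsto C').comp (hu.comp hns)
  obtain ⟨S, hS, φ, -, hv⟩ := exists_subseq_tendsto_ofAff C C'.1 T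
    (hlim.congr fun n => (hT n).symm)
  refine ⟨φ, ?_⟩
  have h1 : Set.domRestrict (Set.range fun T => map T C) y C' = (AffCode.ofAff S).eval x := by
    rw [Set.domRestrict_apply, ← hS, hy, AffCode.eval_ofAff]
  have hc : Continuous fun v : AffCode d => v.eval x := by
    unfold AffCode.eval
    fun_prop
  rw [h1]
  refine ((hc.tendsto _).comp hv).congr fun n => ?_
  simp only [Function.comp_apply, Set.domRestrict_apply]
  rw [← hT, hy, AffCode.eval_ofAff]

/-- Finitely many closed orbits have a closed union, and the space of bodies is metric, hence
normal, so Tietze applies. -/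
theorem exists_continuous_map_eq {ι : Type*} [Finite ι] (K : ι → FullConvexBody d)
    (hK : Pairwise fun i j => ¬ AffinelyEquivalent (K i) (K j))
    (x : ι → EuclideanSpace ℝ (Fin d)) (hx : ∀ i, x i ∈ fixedPoints (K i)) :
    ∃ y : FullConvexBody d → EuclideanSpace ℝ (Fin d), Continuous y ∧
      ∀ i T, y (map T (K i)) = T (x i) := by
  classical
  let y₀ : FullConvexBody d → EuclideanSpace ℝ (Fin d) := fun C =>
    if h : ∃ q : ι × AffTransf d, map q.2 (K q.1) = C then h.choose.2 (x h.choose.1) else 0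
  have hy₀ : ∀ i T, y₀ (map T (K i)) = T (x i) := by
    intro i T
    have h : ∃ q : ι × AffTransf d, map q.2 (K q.1) = map T (K i) := ⟨(i, T), rfl⟩
    simp only [y₀, dif_pos h]
    have hs := h.choose_spec
    generalize h.choose = q at hs
    obtain ⟨j, S⟩ := q
    -- Inequivalence forces `j = i`; then `T⁻¹ * S` stabilizes `K i` and fixes `x i`, so the choice
    -- of representative is immaterial.
    have h1 : map (T⁻¹ * S) (K j) = K i := by
      rw [← map_map, hs, map_inv_map]
    obtain rfl : j = i := by
      by_contra hne
      exact hK hne ⟨_, h1⟩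
    have h2 : T⁻¹ (S (x j)) = x j := hx j _ h1
    exact (T.symm_apply_eq.1 h2)
  have hcl : ∀ i, IsClosed (Set.range fun T => map T (K i)) := fun i => isClosed_orbit (K i)
  have hcont : ContinuousOn y₀ (⋃ i, Set.range fun T => map T (K i)) :=
    (locallyFinite_of_finite _).continuousOn_iUnion hcl fun i => continuousOn_orbit (hy₀ i)
  obtain ⟨g, hg⟩ := ContinuousMap.exists_restrict_eq (isClosed_iUnion_of_finite hcl)
    ⟨_, continuousOn_iff_continuous_domRestrict.1 hcont⟩
  refine ⟨g, g.continuous, fun i T => ?_⟩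
  rw [← hy₀]
  exact DFunLike.congr_fun hg ⟨map T (K i), Set.mem_iUnion.2 ⟨i, T, rfl⟩⟩

end FullConvexBody


/-! ### A cutoff with bounded support along each orbit. -/

namespace FullConvexBody

variable {d : ℕ}

theorem continuous_infDist (z : EuclideanSpace ℝ (Fin d)) :
    Continuous fun C : FullConvexBody d =>
      Metric.infDist z (C.1 : Set (EuclideanSpace ℝ (Fin d))) := by
  refine (LipschitzWith.of_le_add fun C C' => ?_).continuous
  rw [dist_comm]
  exact Metric.infDist_le_infDist_add_hausdorffDist ConvexBody.hausdorffEDist_ne_top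

/-- A continuous weight supported on the bodies that come close to all the points `± 2 d eₖ`. -/
noncomputable def frameWeight (C : FullConvexBody d) : ℝ :=
  max 0 (1 - ∑ k : Fin d,
    (Metric.infDist (EuclideanSpace.single k (2 * d : ℝ)) (C.1 : Set (EuclideanSpace ℝ (Fin d))) +
      Metric.infDist (-EuclideanSpace.single k (2 * d : ℝ))
        (C.1 : Set (EuclideanSpace ℝ (Fin d)))))

theorem continuous_frameWeight : Continuous (frameWeight (d := d)) :=
  continuous_const.max (continuous_const.sub (continuous_finsetSum _ fun _ _ =>
    (continuous_infDist _).add (continuous_infDist _)))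

theorem frameWeight_nonneg (C : FullConvexBody d) : 0 ≤ frameWeight C := le_max_left _ _

theorem frameWeight_le_one (C : FullConvexBody d) : frameWeight C ≤ 1 := by
  refine max_le zero_le_one (sub_le_self _ (Finset.sum_nonneg fun k _ => ?_))
  exact add_nonneg Metric.infDist_nonneg Metric.infDist_nonneg

theorem infDist_lt_one_of_frameWeight_ne_zero {C : FullConvexBody d} (h : frameWeight C ≠ 0)
    (k : Fin d) :
    Metric.infDist (EuclideanSpace.single k (2 * d : ℝ)) (C.1 : Set (EuclideanSpace ℝ (Fin d))) < 1
      ∧ Metric.infDist (-EuclideanSpace.single k (2 * d : ℝ))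
        (C.1 : Set (EuclideanSpace ℝ (Fin d))) < 1 := by
  have h1 : ∑ k : Fin d, (Metric.infDist (EuclideanSpace.single k (2 * d : ℝ))
      (C.1 : Set (EuclideanSpace ℝ (Fin d))) + Metric.infDist (-EuclideanSpace.single k (2 * d : ℝ))
        (C.1 : Set (EuclideanSpace ℝ (Fin d)))) < 1 := by
    by_contra! hle
    exact h (max_eq_left (sub_nonpos.2 hle))
  have h2 := (Finset.single_le_sum (fun k _ => add_nonneg Metric.infDist_nonneg
    Metric.infDist_nonneg) (Finset.mem_univ k)).trans_lt h1
  constructor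
  · exact (le_add_of_nonneg_right Metric.infDist_nonneg).trans_lt h2
  · exact (le_add_of_nonneg_left Metric.infDist_nonneg).trans_lt h2

theorem norm_map_le_of_infDist_lt {C : FullConvexBody d} {R : ℝ} (hR : ∀ z ∈ C.1, ‖z‖ ≤ R)
    (T : AffTransf d) {z : EuclideanSpace ℝ (Fin d)}
    (h : Metric.infDist z ((map T⁻¹ C).1 : Set (EuclideanSpace ℝ (Fin d))) < 1) :
    ‖T z‖ ≤ R + ‖(AffCode.ofAff T).1‖ := by
  obtain ⟨_, ⟨c, hc, rfl⟩, hd⟩ := (Metric.infDist_lt_iff (map T⁻¹ C).1.nonempty).1 h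
  have h1 : T (T⁻¹ c) = c := T.apply_symm_apply c
  have h2 : T z - c = (AffCode.ofAff T).1 (z - T⁻¹ c) := by
    rw [map_sub]
    nth_rw 1 [← h1]
    rw [← AffCode.eval_ofAff T z, ← AffCode.eval_ofAff T (T⁻¹ c), AffCode.eval, AffCode.eval]
    abel
  rw [dist_eq_norm] at hd
  have h3 : ‖T z - c‖ ≤ ‖(AffCode.ofAff T).1‖ := by
    rw [h2]
    exact (ContinuousLinearMap.le_opNorm _ _).trans
      (mul_le_of_le_one_right (norm_nonneg _) hd.le)
  have := norm_le_norm_add_norm_sub c (T z)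
  rw [norm_sub_rev] at this
  linarith [hR c hc, norm_sub_rev c (T z)]

/-- Each `T(± 2 d eₖ)` lies within `‖L‖` of a point of `C`, hence has norm at most `R + ‖L‖`. So `2
d ‖L eₖ‖ ≤ R + ‖L‖`, and summing over `k` gives `2 ‖L‖ ≤ R + ‖L‖`: the factor `2 d` is what allows
`‖L‖` to be absorbed. -/
theorem norm_ofAff_le_of_frameWeight_ne_zero (hd : 0 < d) {C : FullConvexBody d} {R : ℝ}
    (hR : ∀ z ∈ C.1, ‖z‖ ≤ R) {T : AffTransf d} (h : frameWeight (map T⁻¹ C) ≠ 0) :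
    ‖AffCode.ofAff T‖ ≤ 2 * R := by
  set L := (AffCode.ofAff T).1 with hL
  have hT : ∀ z, T z = L z + T 0 := fun z => (AffCode.eval_ofAff T z).symm
  have hpt : ∀ k : Fin d, ‖L (EuclideanSpace.single k (2 * d : ℝ)) + T 0‖ ≤ R + ‖L‖ ∧
      ‖-L (EuclideanSpace.single k (2 * d : ℝ)) + T 0‖ ≤ R + ‖L‖ := by
    intro k
    obtain ⟨h1, h2⟩ := infDist_lt_one_of_frameWeight_ne_zero h k
    rw [← map_neg, ← hT, ← hT]
    exact ⟨norm_map_le_of_infDist_lt hR T h1, norm_map_le_of_infDist_lt hR T h2⟩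
  have hd' : (0 : ℝ) < d := Nat.cast_pos.2 hd
  have hLe : ∀ k : Fin d, 2 * d * ‖L (EuclideanSpace.single k (1 : ℝ))‖ ≤ R + ‖L‖ := by
    intro k
    obtain ⟨h1, h2⟩ := hpt k
    have h3 : L (EuclideanSpace.single k (2 * d : ℝ)) =
        (2 * d : ℝ) • L (EuclideanSpace.single k (1 : ℝ)) := by
      rw [← map_smul]
      congr 1
      ext j
      simp
    have h4 : ‖L (EuclideanSpace.single k (2 * d : ℝ))‖ =
        2 * d * ‖L (EuclideanSpace.single k (1 : ℝ))‖ := by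
      rw [h3, norm_smul, Real.norm_of_nonneg (by positivity)]
    rw [← h4]
    -- Subtracting the images of opposite points eliminates the translation part.
    have h5 := norm_sub_le (L (EuclideanSpace.single k (2 * d : ℝ)) + T 0)
      (-L (EuclideanSpace.single k (2 * d : ℝ)) + T 0)
    rw [add_sub_add_right_eq_sub, sub_neg_eq_add, ← two_smul ℝ, norm_smul, Real.norm_ofNat] at h5
    linarith
  have hsum : ‖L‖ ≤ ∑ k : Fin d, ‖L (EuclideanSpace.single k (1 : ℝ))‖ := by
    refine L.opNorm_le_bound (Finset.sum_nonneg fun _ _ => norm_nonneg _) fun z => ?_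
    have hz : z = ∑ k : Fin d, z k • EuclideanSpace.single k (1 : ℝ) := by
      ext j
      simp [Pi.single_apply]
    conv_lhs => rw [hz, map_sum]
    rw [Finset.sum_mul]
    refine (norm_sum_le _ _).trans (Finset.sum_le_sum fun k _ => ?_)
    rw [map_smul, norm_smul, mul_comm]
    gcongr
    exact PiLp.norm_apply_le z k
  have hLR : ‖L‖ ≤ R := by
    have h1 : ∑ k : Fin d, 2 * d * ‖L (EuclideanSpace.single k (1 : ℝ))‖ ≤ d * (R + ‖L‖) := by
      refine (Finset.sum_le_sum fun k _ => hLe k).trans_eq ?_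
      rw [Finset.sum_const, Finset.card_univ, Fintype.card_fin, nsmul_eq_mul]
    rw [← Finset.mul_sum] at h1
    have h2 : d * (2 * ‖L‖) ≤ d * (R + ‖L‖) := by
      refine le_trans ?_ h1
      rw [← mul_assoc, mul_comm (d : ℝ) 2]
      gcongr
    linarith [le_of_mul_le_mul_left h2 hd']
  have hb : ‖T 0‖ ≤ R + ‖L‖ := by
    obtain ⟨h1, h2⟩ := hpt ⟨0, hd⟩
    -- Adding them instead isolates the translation part.
    have h5 := norm_add_le (L (EuclideanSpace.single ⟨0, hd⟩ (2 * d : ℝ)) + T 0)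
      (-L (EuclideanSpace.single ⟨0, hd⟩ (2 * d : ℝ)) + T 0)
    rw [add_add_add_comm, add_neg_cancel, zero_add, ← two_smul ℝ, norm_smul,
      Real.norm_ofNat] at h5
    linarith
  have hR0 : 0 ≤ R := (norm_nonneg L).trans hLR
  exact max_le (by linarith) (hb.trans (by linarith))

theorem exists_frameWeight_pos (C : FullConvexBody d) :
    ∃ T : AffTransf d, 0 < frameWeight (map T⁻¹ C) := by
  obtain ⟨c, hc⟩ := C.2
  obtain ⟨ρ, hρ, hball⟩ := Metric.isOpen_iff.1 isOpen_interior c hc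
  -- `z ↦ t • z + c` sends the closed ball of radius `2 d` into the open ball of radius `ρ`; the `+
  -- 1` makes the inclusion strict.
  have ht : 0 < ρ / (2 * d + 1) := by positivity
  set t := ρ / (2 * d + 1) with ht_def
  obtain ⟨T, hT⟩ := AffCode.exists_ofAff_eq (d := d)
    (v := (t • ContinuousLinearMap.id ℝ _, c)) fun z => ⟨t⁻¹ • z, by simp [ht.ne']⟩
  have hTz : ∀ z, T z = t • z + c := fun z => by
    rw [← AffCode.eval_ofAff, hT]
    simp [AffCode.eval]
  have hmem : ∀ z : EuclideanSpace ℝ (Fin d), ‖z‖ ≤ 2 * d → z ∈ (map T⁻¹ C).1 := by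
    intro z hz
    refine ⟨T z, interior_subset (hball ?_), T.symm_apply_apply z⟩
    rw [Metric.mem_ball, hTz, dist_add_self_left, norm_smul, Real.norm_of_nonneg ht.le]
    calc t * ‖z‖ ≤ t * (2 * d) := by gcongr
      _ < t * (2 * d + 1) := by gcongr; linarith
      _ = ρ := by rw [ht_def]; field_simp
  refine ⟨T, ?_⟩
  have hzero : ∀ z : EuclideanSpace ℝ (Fin d), ‖z‖ ≤ 2 * d →
      Metric.infDist z ((map T⁻¹ C).1 : Set (EuclideanSpace ℝ (Fin d))) = 0 :=
    fun z hz => Metric.infDist_zero_of_mem (hmem z hz)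
  rw [frameWeight, Finset.sum_eq_zero]
  · simp
  · intro k _
    rw [hzero, hzero, add_zero] <;> simp

/-! ### Integration over the affine group. -/

/-- The Haar measure of the space of affine maps, restricted to the invertible ones. -/
noncomputable def affMeasure (d : ℕ) : Measure (AffCode d) :=
  (Measure.addHaar : Measure (AffCode d)).restrict (Set.range AffCode.ofAff)

theorem ae_affMeasure {P : AffCode d → Prop} (h : ∀ T, P (AffCode.ofAff T)) :
    ∀ᵐ v ∂affMeasure d, P v := by
  refine (ae_restrict_iff' AffCode.isOpen_range_ofAff.measurableSet).2 (ae_of_all _ ?_)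
  rintro _ ⟨T, rfl⟩
  exact h T

section Integral

variable {F : Type*} [NormedAddCommGroup F]
  {g : AffCode d → FullConvexBody d → F}

theorem aestronglyMeasurable_pullback (hg : Continuous (Function.uncurry g))
    [SecondCountableTopologyEither (AffCode d) F] (C : FullConvexBody d) :
    AEStronglyMeasurable (fun v => g v (map (AffCode.toAff v)⁻¹ C)) (affMeasure d) :=
  (hg.comp_continuousOn (continuousOn_id.prodMk
    (continuousOn_map_toAff_inv C))).aestronglyMeasurable
      AffCode.isOpen_range_ofAff.measurableSet

theorem integrable_bound (M : ℝ) :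
    Integrable ((Metric.closedBall (0 : AffCode d) M).indicator fun _ => 1 + M) (affMeasure d) := by
  refine Integrable.mono_measure ?_ Measure.restrict_le_self
  rw [integrable_indicator_iff Metric.isClosed_closedBall.measurableSet]
  exact integrableOn_const (isCompact_closedBall _ _).measure_lt_top.ne

theorem ae_norm_pullback_le (hd : 0 < d) (hsupp : ∀ v C, g v C ≠ 0 → frameWeight C ≠ 0)
    (hbound : ∀ v C, ‖g v C‖ ≤ 1 + ‖v‖) {C : FullConvexBody d} {R : ℝ}
    (hR : ∀ z ∈ C.1, ‖z‖ ≤ R) :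
    ∀ᵐ v ∂affMeasure d, ‖g v (map (AffCode.toAff v)⁻¹ C)‖ ≤
      (Metric.closedBall (0 : AffCode d) (2 * R)).indicator (fun _ => 1 + 2 * R) v := by
  refine ae_affMeasure fun T => ?_
  rw [AffCode.toAff_ofAff]
  by_cases h : g (AffCode.ofAff T) (map T⁻¹ C) = 0
  · rw [h, norm_zero]
    refine Set.indicator_nonneg (fun v hv => ?_) _
    have := (norm_nonneg v).trans (mem_closedBall_zero_iff.1 hv)
    linarith
  · have hT := norm_ofAff_le_of_frameWeight_ne_zero hd hR (hsupp _ _ h)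
    rw [Set.indicator_of_mem (mem_closedBall_zero_iff.2 hT)]
    exact (hbound _ _).trans (by gcongr)

theorem integrable_pullback (hd : 0 < d) (hg : Continuous (Function.uncurry g))
    (hsupp : ∀ v C, g v C ≠ 0 → frameWeight C ≠ 0) (hbound : ∀ v C, ‖g v C‖ ≤ 1 + ‖v‖)
    (C : FullConvexBody d) :
    Integrable (fun v => g v (map (AffCode.toAff v)⁻¹ C)) (affMeasure d) := by
  obtain ⟨R, hR⟩ := C.1.isBounded.exists_norm_le
  exact (integrable_bound (2 * R)).mono' (aestronglyMeasurable_pullback hg C)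
    (ae_norm_pullback_le hd hsupp hbound hR)

theorem continuous_integral_pullback [NormedSpace ℝ F] (hd : 0 < d) (hg : Continuous (Function.uncurry g))
    (hsupp : ∀ v C, g v C ≠ 0 → frameWeight C ≠ 0) (hbound : ∀ v C, ‖g v C‖ ≤ 1 + ‖v‖) :
    Continuous fun C => ∫ v, g v (map (AffCode.toAff v)⁻¹ C) ∂affMeasure d := by
  refine continuous_iff_continuousAt.2 fun C₀ => ?_
  obtain ⟨R, hR⟩ := C₀.1.isBounded.exists_norm_le
  refine continuousAt_of_dominated
    (Eventually.of_forall fun C => aestronglyMeasurable_pullback hg C) ?_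
    (integrable_bound (2 * (R + 1))) ?_
  -- Bodies within distance 1 of `C₀` lie in the ball of radius `R + 1`, so one dominating function
  -- serves them all.
  · filter_upwards [Metric.closedBall_mem_nhds C₀ one_pos] with C hC
    exact ae_norm_pullback_le hd hsupp hbound (norm_le_of_dist_le hR hC)
  · exact ae_of_all _ fun v => (hg.comp (continuous_const.prodMk
      (continuous_map (AffCode.toAff v)⁻¹))).continuousAt

end Integral

/-! ### Left translation and the averaged point. -/

/-- Composition with `S` on the left, as a linear automorphism followed by a translation. -/
noncomputable def leftMulLinear (S : AffTransf d) : AffCode d ≃L[ℝ] AffCode d :=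
  (ContinuousLinearEquiv.arrowCongr (ContinuousLinearEquiv.refl ℝ _)
    S.linear.toContinuousLinearEquiv).prodCongr S.linear.toContinuousLinearEquiv

theorem eval_leftMul (S : AffTransf d) (v : AffCode d) (z : EuclideanSpace ℝ (Fin d)) :
    (leftMulLinear S v + (0, S 0)).eval z = S (v.eval z) := by
  rw [← AffCode.eval_ofAff S (v.eval z), AffCode.eval, AffCode.eval, AffCode.eval, map_add]
  change S.linear (v.1 z) + 0 + (S.linear v.2 + S 0) = S.linear (v.1 z) + S.linear v.2 + S 0
  abel

theorem leftMul_ofAff (S T : AffTransf d) :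
    leftMulLinear S (AffCode.ofAff T) + (0, S 0) = AffCode.ofAff (S * T) := by
  have h : ∀ z, (leftMulLinear S (AffCode.ofAff T) + (0, S 0)).eval z =
      (AffCode.ofAff (S * T)).eval z := by
    intro z
    rw [eval_leftMul, AffCode.eval_ofAff, AffCode.eval_ofAff]
    rfl
  refine Prod.ext (ContinuousLinearMap.ext fun z => ?_) ?_
  · exact add_zero _
  · have h0 := h 0
    simpa only [AffCode.eval, map_zero, zero_add] using h0

theorem leftMul_mem_range_iff (S : AffTransf d) (v : AffCode d) :
    leftMulLinear S v + (0, S 0) ∈ Set.range (AffCode.ofAff (d := d)) ↔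
      v ∈ Set.range (AffCode.ofAff (d := d)) := by
  constructor
  · rintro ⟨T, hT⟩
    refine ⟨S⁻¹ * T, (leftMulLinear S).injective (add_right_cancel (b := (0, S 0)) ?_)⟩
    rw [leftMul_ofAff, mul_inv_cancel_left, hT]
  · rintro ⟨T, rfl⟩
    exact ⟨_, (leftMul_ofAff S T).symm⟩

/-- Left multiplication by `S` is an affine bijection of the space of pairs preserving
invertibility, so `κ` is its inverse absolute determinant. It is chosen before `F` so that the
scalar and the vector integral share it. -/
theorem exists_integral_leftMul (S : AffTransf d) : ∃ κ : ℝ, κ ≠ 0 ∧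
    ∀ {F : Type} [NormedAddCommGroup F] [NormedSpace ℝ F] (h : AffCode d → F),
      ∫ v, h (leftMulLinear S v + (0, S 0)) ∂affMeasure d = κ • ∫ v, h v ∂affMeasure d := by
  have hdet : LinearMap.det ((leftMulLinear S).toLinearEquiv : AffCode d →ₗ[ℝ] AffCode d) ≠ 0 :=
    (LinearEquiv.isUnit_det' _).ne_zero
  refine ⟨_, abs_ne_zero.2 (inv_ne_zero hdet), fun {F} _ _ h => ?_⟩
  have hmeas := AffCode.isOpen_range_ofAff (d := d).measurableSet
  have hmap := Measure.map_linearMap_addHaar_eq_smul_addHaar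
    (Measure.addHaar : Measure (AffCode d)) hdet
  rw [affMeasure, ← integral_indicator hmeas, ← integral_indicator hmeas,
    ← integral_add_right_eq_self ((Set.range AffCode.ofAff).indicator h) ((0, S 0) : AffCode d)]
  have h1 := congrArg (fun μ => ∫ v, (Set.range AffCode.ofAff).indicator h
    (v + ((0, S 0) : AffCode d)) ∂μ) hmap
  simp only [integral_smul_measure, ENNReal.toReal_ofReal (abs_nonneg _)] at h1
  rw [← h1]
  have h2 := (leftMulLinear S).toHomeomorph.measurableEmbedding.integral_map
    (μ := (Measure.addHaar : Measure (AffCode d)))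
    (fun v => (Set.range AffCode.ofAff).indicator h (v + ((0, S 0) : AffCode d)))
  refine Eq.trans ?_ h2.symm
  refine integral_congr_ae (ae_of_all _ fun v => ?_)
  have h3 := leftMul_mem_range_iff S v
  by_cases hv : v ∈ Set.range (AffCode.ofAff (d := d))
  · rw [Set.indicator_of_mem hv]
    exact (Set.indicator_of_mem (h3.2 hv) h).symm
  · rw [Set.indicator_of_notMem hv]
    exact (Set.indicator_of_notMem (fun hh => hv (h3.1 hh)) h).symm

/-- The normalized average of an arbitrary continuous map over all affine positions is an
affine invariant point. -/
theorem exists_isAffineInvariantPoint_of_continuous (hd : 0 < d)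
    {y : FullConvexBody d → EuclideanSpace ℝ (Fin d)} (hy : Continuous y) :
    ∃ p : FullConvexBody d → EuclideanSpace ℝ (Fin d), IsAffineInvariantPoint p ∧
      ∀ C x, (∀ T, y (map T C) = T x) → p C = x := by
  -- Dividing by `1 + ‖y C‖` compensates for `y` being possibly unbounded: the integrands are then
  -- at most `1 + ‖v‖`.
  set w : FullConvexBody d → ℝ := fun C => frameWeight C / (1 + ‖y C‖) with hw_def
  have hpos : ∀ C, 0 < 1 + ‖y C‖ := fun C => by positivity
  have hw : Continuous w := continuous_frameWeight.div (by fun_prop) fun C => (hpos C).ne'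
  have hw0 : ∀ C, 0 ≤ w C := fun C => div_nonneg (frameWeight_nonneg C) (hpos C).le
  have hwy : ∀ C, w C * (1 + ‖y C‖) ≤ 1 := fun C => by
    rw [div_mul_cancel₀ _ (hpos C).ne']
    exact frameWeight_le_one C
  have hwsupp : ∀ C, w C ≠ 0 → frameWeight C ≠ 0 := fun C h h0 => h (by simp [hw_def, h0])
  let gD : AffCode d → FullConvexBody d → ℝ := fun _ C => w C
  let gN : AffCode d → FullConvexBody d → EuclideanSpace ℝ (Fin d) := fun v C =>
    w C • v.eval (y C)
  have hgD : Continuous (Function.uncurry gD) := hw.comp continuous_snd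
  have hgN : Continuous (Function.uncurry gN) := by
    refine (hw.comp continuous_snd).smul ?_
    exact ((continuous_fst.comp continuous_fst).clm_apply (hy.comp continuous_snd)).add
      (continuous_snd.comp continuous_fst)
  have hDs : ∀ v C, gD v C ≠ 0 → frameWeight C ≠ 0 := fun _ C h => hwsupp C h
  have hNs : ∀ v C, gN v C ≠ 0 → frameWeight C ≠ 0 := fun _ C h =>
    hwsupp C fun h0 => h (by simp [gN, h0])
  have hDb : ∀ v C, ‖gD v C‖ ≤ 1 + ‖v‖ := fun v C => by
    rw [Real.norm_of_nonneg (hw0 C)]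
    nlinarith [hwy C, mul_nonneg (hw0 C) (norm_nonneg (y C)), norm_nonneg v]
  have hNb : ∀ v C, ‖gN v C‖ ≤ 1 + ‖v‖ := fun v C => by
    have h1 : ‖v.eval (y C)‖ ≤ ‖v‖ * (1 + ‖y C‖) := by
      calc ‖v.eval (y C)‖ ≤ ‖v.1‖ * ‖y C‖ + ‖v.2‖ :=
            (norm_add_le _ _).trans (by gcongr; exact v.1.le_opNorm _)
        _ ≤ ‖v‖ * ‖y C‖ + ‖v‖ := by
            gcongr
            · exact norm_fst_le v
            · exact norm_snd_le v
        _ = ‖v‖ * (1 + ‖y C‖) := by ring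
    rw [norm_smul, Real.norm_of_nonneg (hw0 C)]
    calc w C * ‖v.eval (y C)‖ ≤ w C * (‖v‖ * (1 + ‖y C‖)) := by
          gcongr
          exact hw0 C
      _ = ‖v‖ * (w C * (1 + ‖y C‖)) := by ring
      _ ≤ ‖v‖ * 1 := by gcongr; exact hwy C
      _ ≤ 1 + ‖v‖ := by linarith
  let D : FullConvexBody d → ℝ := fun C => ∫ v, gD v (map (AffCode.toAff v)⁻¹ C) ∂affMeasure d
  let N : FullConvexBody d → EuclideanSpace ℝ (Fin d) := fun C =>
    ∫ v, gN v (map (AffCode.toAff v)⁻¹ C) ∂affMeasure d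
  have hDi := integrable_pullback hd hgD hDs hDb
  have hNi := integrable_pullback hd hgN hNs hNb
  have hDpos : ∀ C, 0 < D C := by
    intro C
    refine (integral_pos_iff_support_of_nonneg (fun v => hw0 _) (hDi C)).2 ?_
    -- The integrand is positive on a nonempty open set, which has positive Haar measure.
    have hopen := (hw.comp_continuousOn (continuousOn_map_toAff_inv C)).isOpen_inter_preimage
      AffCode.isOpen_range_ofAff isOpen_Ioi (t := Set.Ioi 0)
    have hne : (Set.range AffCode.ofAff ∩ (w ∘ fun v : AffCode d =>
        map (AffCode.toAff v)⁻¹ C) ⁻¹' Set.Ioi 0).Nonempty := by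
      obtain ⟨T, hT⟩ := exists_frameWeight_pos C
      refine ⟨AffCode.ofAff T, ⟨T, rfl⟩, ?_⟩
      rw [Set.mem_preimage, Function.comp_apply, AffCode.toAff_ofAff]
      exact div_pos hT (hpos _)
    rw [affMeasure, Measure.restrict_apply' AffCode.isOpen_range_ofAff.measurableSet]
    refine (hopen.measure_pos Measure.addHaar hne).trans_le (measure_mono ?_)
    exact fun v hv => ⟨ne_of_gt hv.2, hv.1⟩
  refine ⟨fun C => (D C)⁻¹ • N C, ⟨?_, fun S C => ?_⟩, fun C x hx => ?_⟩
  · exact ((continuous_integral_pullback hd hgD hDs hDb).inv₀ fun C => (hDpos C).ne').smul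
      (continuous_integral_pullback hd hgN hNs hNb)
  · obtain ⟨κ, hκ, hint⟩ := exists_integral_leftMul S
    have hbody : ∀ T : AffTransf d, map (S * T)⁻¹ (map S C) = map T⁻¹ C := fun T => by
      rw [map_map, mul_inv_rev, inv_mul_cancel_right]
    have hDS : κ * D (map S C) = D C := by
      rw [← smul_eq_mul, ← hint]
      refine integral_congr_ae (ae_affMeasure fun T => ?_)
      simp only [gD]
      rw [leftMul_ofAff, AffCode.toAff_ofAff, AffCode.toAff_ofAff, hbody]
    -- Substituting `S * T` for `T` puts `S` outside `T`; the constant part `S 0` is integrated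
    -- against the weight and contributes `D C • S 0`.
    have hNS : κ • N (map S C) = (AffCode.ofAff S).1 (N C) + D C • S 0 := by
      rw [← hint, ← ContinuousLinearMap.integral_comp_comm _ (hNi C), ← integral_smul_const,
        ← integral_add ((AffCode.ofAff S).1.integrable_comp (hNi C)) ((hDi C).smul_const _)]
      refine integral_congr_ae (ae_affMeasure fun T => ?_)
      simp only [gN, gD]
      rw [eval_leftMul, leftMul_ofAff, AffCode.toAff_ofAff, AffCode.toAff_ofAff, hbody, map_smul,
        ← smul_add, ← AffCode.eval_ofAff S]
      rfl
    have hD0 : D (map S C) ≠ 0 := (hDpos _).ne'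
    calc (D (map S C))⁻¹ • N (map S C) = (D C)⁻¹ • κ • N (map S C) := by
          rw [← hDS, smul_smul]
          congr 1
          field_simp
      _ = S ((D C)⁻¹ • N C) := by
          rw [hNS, smul_add, smul_smul, inv_mul_cancel₀ (hDpos C).ne', one_smul, ← map_smul,
            ← AffCode.eval_ofAff S ((D C)⁻¹ • N C)]
          rfl
  · have hN : N C = D C • x := by
      rw [← integral_smul_const]
      refine integral_congr_ae (ae_affMeasure fun T => ?_)
      simp only [gN, gD]
      rw [AffCode.toAff_ofAff, hx, AffCode.eval_ofAff]
      congr 1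
      exact T.apply_symm_apply x
    change (D C)⁻¹ • N C = x
    rw [hN, smul_smul, inv_mul_cancel₀ (hDpos C).ne', one_smul]

end FullConvexBody

theorem corollary4p1 (d : ℕ) (hd : 2 ≤ d) (m : ℕ) (K : Fin m → FullConvexBody d)
    (hK : Pairwise fun i j => ¬ FullConvexBody.AffinelyEquivalent (K i) (K j))
    (x : Fin m → EuclideanSpace ℝ (Fin d)) (hx : ∀ i, x i ∈ FullConvexBody.fixedPoints (K i)) :
    ∃ p : FullConvexBody d → EuclideanSpace ℝ (Fin d),
      IsAffineInvariantPoint p ∧ ∀ i, p (K i) = x i := by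
  obtain ⟨y, hy, hyK⟩ := FullConvexBody.exists_continuous_map_eq K hK x hx
  obtain ⟨p, hp, hpx⟩ :=
    FullConvexBody.exists_isAffineInvariantPoint_of_continuous (by omega) hy
  exact ⟨p, hp, fun i => hpx (K i) (x i) (hyK i)⟩
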